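/- Let $K$ be a field of characteristic zero, let $V$ and $W$ be finite-dimensional vector spaces over $K$, and let $G \leqslant \mathrm{GL}(V)$ and $H \leqslant \mathrm{GL}(W)$ be finite nilpotent primitive linear groups. If $G$ and $H$ are isomorphic as abstract groups, then $G$ and $H$ are similar, that is, there exists a $K$-isomorphism $\theta\colon V \to W$ such that $\theta G \theta^{-1} = H$. Here a linear group $G \leqslant \mathrm{GL}(V)$ is irreducible if $V \neq 0$ and the only $G$-invariant subspaces of $V$ are $0$ and $V$; an irreducible linear group $G \leqslant \mathrm{GL}(V)$ is primitive if there is no decomposition $V = U_1 \oplus \dotsb \oplus U_r$ into a direct sum of proper subspaces (subspaces different from $V$) that are permuted by $G$. -/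

import Mathlib

/-- A linear group `G ≤ GL(V)` over `K` is irreducible if its natural representation on `V` is
irreducible: `V ≠ 0`, and `0` and `V` are the only `G`-invariant subspaces of `V`. -/
def IsIrreducibleLinearGroup {K V : Type*} [Field K] [AddCommGroup V] [Module K V]
    (G : Subgroup (LinearMap.GeneralLinearGroup K V)) : Prop :=
  Representation.IsIrreducible
    ((Units.coeHom (V →ₗ[K] V)).comp G.subtype : Representation K G V)

/-- `G ≤ GL(V)` permutes a decomposition `V = U₁ ⊕ ⋯ ⊕ Uᵣ` into a direct sum of proper
subspaces, that is, subspaces different from `V`. -/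
def PermutesProperDecomposition {K V : Type*} [Field K] [AddCommGroup V] [Module K V]
    (G : Subgroup (LinearMap.GeneralLinearGroup K V)) : Prop :=
  ∃ (r : ℕ) (U : Fin r → Submodule K V),
    DirectSum.IsInternal U ∧ (∀ i, U i ≠ ⊤) ∧
      ∀ g ∈ G, ∃ σ : Equiv.Perm (Fin r), ∀ i, (U i).map (g : V →ₗ[K] V) = U (σ i)

/-- An irreducible linear group is primitive if it is not imprimitive, that is, if it does not
permute the summands of a decomposition of the space into proper subspaces. -/
def IsPrimitiveLinearGroup {K V : Type*} [Field K] [AddCommGroup V] [Module K V]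
    (G : Subgroup (LinearMap.GeneralLinearGroup K V)) : Prop :=
  IsIrreducibleLinearGroup G ∧ ¬ PermutesProperDecomposition G

/-- Linear groups `G ≤ GL(V)` and `H ≤ GL(W)` over `K` are similar if conjugation by some
`K`-isomorphism `θ : V → W` carries `G` onto `H`. -/
def AreSimilarLinearGroups {K V W : Type*} [Field K] [AddCommGroup V] [Module K V]
    [AddCommGroup W] [Module K W]
    (G : Subgroup (LinearMap.GeneralLinearGroup K V))
    (H : Subgroup (LinearMap.GeneralLinearGroup K W)) : Prop :=
  ∃ θ : V ≃ₗ[K] W,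
    G.map (LinearMap.GeneralLinearGroup.congrLinearEquiv θ).toMonoidHom = H

/-!
Let `G` be a finite nilpotent primitive linear group on `V`. An abelian normal subgroup `A` of `G`
generates a commutative subalgebra `K[A]` of `End V`; the subspaces of `V` killed by the maximal
ideals of `K[A]` are independent and permuted by `G`, so by primitivity one of them is `V`, and
`K[A]` is a field (`IsPrimitiveLinearGroup.isField_adjoin`). Hence every abelian normal
subgroup of `G` is cyclic.

For finite nilpotent groups this is very restrictive (`exists_cyclic_index_le_two`). A maximal abelian
normal subgroup `⟨x⟩` is its own centralizer. If an element `b` outside it acted on it by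
`x ↦ x ^ s` with `s ≡ 1 (mod 4)`, then replacing `b` by a power one could assume `b ^ p ∈ ⟨x⟩` for a
prime `p`, and some `x ^ e * b` would have order `p` and generate with its conjugates a
noncyclic elementary abelian normal subgroup (`mem_zpowers_of_pow_prime_mem`). So `⟨x⟩` has index at
most `2`, and if the index is `2`, there is an element `b` outside `⟨x⟩` with `b ^ 4 = 1`.

Now let `φ : G ≃* H`. Since `K[x]` and `K[φ x]` are fields and `x`, `φ x` have the same order, some
`y = φ x ^ j` with `j` prime to that order has the same minimal polynomial as `x`. Thus there is a
nonzero `T : V → W` with `T x = y T`. If `G = ⟨x⟩`, Schur's lemma makes `T` an isomorphism, which carries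
`G = ⟨x⟩` to `H = ⟨y⟩`. Otherwise put `d = φ b`; the pairs `(x, b)` and `(y, d)` satisfy the
same relations, where `b ^ 4 = 1` and `j` odd ensure that `b ^ 2 = x ^ t` implies `d ^ 2 = y ^ t`. The
operator `T + d T b⁻¹` intertwines both pairs, and it is nonzero for `T` or for `y T`, because
`d y d⁻¹ - y` is invertible (`exists_ne_zero_intertwining_pair`). Schur's lemma again gives the
similarity. The isomorphism `G ≃* H` that it induces need not be `φ`.
-/

/-! ### Cyclic normal subgroups of finite nilpotent groups -/

theorem zpow_conj_of_conj_eq_zpow {G : Type*} [Group G] {x b : G} {s : ℤ}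
    (h : b * x * b⁻¹ = x ^ s) (k : ℤ) : b * x ^ k = x ^ (s * k) * b := by
  rw [zpow_mul, ← h, conj_zpow]; group

theorem pow_conj_of_conj_eq_zpow {G : Type*} [Group G] {x b : G} {s : ℤ}
    (h : b * x * b⁻¹ = x ^ s) (m : ℕ) : b ^ m * x * (b ^ m)⁻¹ = x ^ (s ^ m) := by
  induction m with
  | zero => simp
  | succ m ih =>
    calc b ^ (m + 1) * x * (b ^ (m + 1))⁻¹ = b * (b ^ m * x * (b ^ m)⁻¹) * b⁻¹ := by
          rw [pow_succ']; group
      _ = x ^ (s ^ (m + 1)) := by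
          rw [ih, zpow_conj_of_conj_eq_zpow h, pow_succ']; group

theorem zpow_mul_pow_of_conj_eq_zpow {G : Type*} [Group G] {x b : G} {s : ℤ}
    (h : b * x * b⁻¹ = x ^ s) (e : ℤ) (k : ℕ) :
    (x ^ e * b) ^ k = x ^ (e * ∑ i ∈ Finset.range k, s ^ i) * b ^ k := by
  induction k with
  | zero => simp
  | succ k ih =>
    calc (x ^ e * b) ^ (k + 1) = x ^ e * (b * x ^ (e * ∑ i ∈ Finset.range k, s ^ i)) * b ^ k := by
          rw [pow_succ', ih]; group
      _ = x ^ (e * ∑ i ∈ Finset.range (k + 1), s ^ i) * b ^ (k + 1) := by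
          rw [zpow_conj_of_conj_eq_zpow h, geom_sum_succ, mul_add, zpow_add, pow_succ', mul_left_comm]
          group

/-- If `s ≡ 1` modulo every prime divisor of `n` and `s` has prime order `p` modulo `n`, with
`s ≡ 1 (mod 4)` in case `p = 2`, then `1 + s + ⋯ + s ^ (p - 1)` is `p` times a unit modulo `n`. -/
theorem exists_geom_sum_eq_prime_mul {n p : ℕ} {s : ℤ} (hp : p.Prime)
    (hrad : ∀ q : ℕ, q.Prime → q ∣ n → (q : ℤ) ∣ s - 1) (hpow : (n : ℤ) ∣ s ^ p - 1)
    (hs : ¬ (n : ℤ) ∣ s - 1) (htwo : p = 2 → (4 : ℤ) ∣ s - 1) :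
    p ∣ n ∧ ∃ w : ℤ, ∑ i ∈ Finset.range p, s ^ i = p * w ∧ IsCoprime w (n : ℤ) ∧
      (n : ℤ) ∣ p * (s - 1) := by
  set Φ := ∑ i ∈ Finset.range p, s ^ i with hΦ
  have hfac : Φ * (s - 1) = s ^ p - 1 := geom_sum_mul s p
  have hcongr : ∀ d : ℤ, d ∣ s - 1 → d ∣ Φ - p := by
    intro d hd
    have : Φ - p = ∑ i ∈ Finset.range p, (s ^ i - 1) := by simp [hΦ]
    rw [this]
    exact Finset.dvd_sum fun i _ ↦ hd.trans (sub_one_dvd_pow_sub_one s i)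
  have hcop : ∀ u : ℤ, (∀ q : ℕ, q.Prime → q ∣ n → ¬ (q : ℤ) ∣ u) → IsCoprime u (n : ℤ) := by
    intro u hu
    rw [Int.isCoprime_iff_gcd_eq_one]
    by_contra hne
    obtain ⟨q, hq, hqd⟩ := Nat.exists_prime_and_dvd hne
    have h1 : (q : ℤ) ∣ u := (Int.natCast_dvd_natCast.2 hqd).trans (Int.gcd_dvd_left _ _)
    have h2 : (q : ℤ) ∣ n := (Int.natCast_dvd_natCast.2 hqd).trans (Int.gcd_dvd_right _ _)
    exact hu q hq (Int.natCast_dvd_natCast.1 h2) h1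
  have hqp : ∀ q : ℕ, q.Prime → q ∣ n → (q : ℤ) ∣ Φ → q = p := by
    intro q hq hqn hqΦ
    have h1 : (q : ℤ) ∣ p := by
      have := dvd_sub hqΦ (hcongr q (hrad q hq hqn))
      simpa using this
    exact (Nat.prime_dvd_prime_iff_eq hq hp).1 (Int.natCast_dvd_natCast.1 h1)
  have hpn : p ∣ n := by
    by_contra hpn
    have : IsCoprime Φ (n : ℤ) := hcop Φ fun q hq hqn hqΦ ↦ hpn (hqp q hq hqn hqΦ ▸ hqn)
    exact hs (this.symm.dvd_of_dvd_mul_left (hfac ▸ hpow))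
  refine ⟨hpn, ?_⟩
  have hps := hrad p hp hpn
  have hp0 : (p : ℤ) ≠ 0 := by exact_mod_cast hp.ne_zero
  -- the sum is congruent to `p` modulo `p ^ 2`
  have hsq : (p : ℤ) ^ 2 ∣ Φ - p := by
    rcases hp.eq_two_or_odd' with rfl | hodd
    · have := htwo rfl
      have h2 : Φ = s + 1 := by simp [hΦ, Finset.sum_range_succ, add_comm]
      rw [h2]; norm_num; convert this using 1; ring
    · obtain ⟨c, hc⟩ := hps
      have := odd_sq_dvd_geom_sum₂_sub (R := ℤ) 1 c hodd
      simpa [hΦ, ← hc] using this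
  obtain ⟨w, hw⟩ : (p : ℤ) ∣ Φ := by
    have := (Dvd.intro_left _ (sq (p : ℤ)).symm).trans hsq
    simpa using dvd_add this (dvd_refl (p : ℤ))
  have hwn : IsCoprime w (n : ℤ) := by
    apply hcop
    intro q hq hqn hqw
    obtain rfl := hqp q hq hqn (hw ▸ hqw.mul_left _)
    obtain ⟨c, hc⟩ := hsq
    obtain ⟨d, hd⟩ := hqw
    have : (q : ℤ) * (q * (d - c) ) = q * 1 := by linear_combination hc - hw - q * hd
    have h1 := mul_left_cancel₀ hp0 this
    have := Int.isUnit_iff.1 (IsUnit.of_mul_eq_one _ h1)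
    have := hq.two_le
    omega
  refine ⟨w, hw, hwn, hwn.symm.dvd_of_dvd_mul_left (?_ : (n : ℤ) ∣ w * _)⟩
  rw [← hfac, hw] at hpow
  convert hpow using 1
  ring

/-- If `⟨x⟩` is self-centralizing and normal and `b ^ p ∈ ⟨x⟩`, where `b` acts on `⟨x⟩` as raising to
the power `s` with `s ≡ 1` modulo the primes dividing the order of `x` (and modulo `4` if `p = 2`),
then `b ∈ ⟨x⟩`. Otherwise some `x ^ e * b` has order `p`, and its conjugates generate a noncyclic
elementary abelian normal subgroup. -/
theorem mem_zpowers_of_pow_prime_mem {G : Type*} [Group G] [Finite G]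
    (hcyc : ∀ N : Subgroup G, N.Normal → (∀ a ∈ N, ∀ b ∈ N, a * b = b * a) → IsCyclic N)
    {x : G} (hnormal : (Subgroup.zpowers x).Normal)
    (hcent : ∀ g : G, g * x = x * g → g ∈ Subgroup.zpowers x)
    {b : G} {s : ℤ} {p : ℕ} (hp : p.Prime)
    (hbp : b ^ p ∈ Subgroup.zpowers x) (hbx : b * x * b⁻¹ = x ^ s)
    (hrad : ∀ q : ℕ, q.Prime → q ∣ orderOf x → (q : ℤ) ∣ s - 1)
    (htwo : p = 2 → (4 : ℤ) ∣ s - 1) : b ∈ Subgroup.zpowers x := by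
  by_contra hb
  set n := orderOf x with hn
  have hone : ∀ k : ℤ, x ^ k = 1 ↔ (n : ℤ) ∣ k := fun k ↦ orderOf_dvd_iff_zpow_eq_one.symm
  have heq : ∀ k l : ℤ, x ^ k = x ^ l ↔ (n : ℤ) ∣ k - l := fun k l ↦ by
    rw [← hone, zpow_sub, mul_inv_eq_one]
  obtain ⟨t, ht⟩ := Subgroup.mem_zpowers_iff.1 hbp
  have hs : ¬ (n : ℤ) ∣ s - 1 := by
    rw [← heq, zpow_one, ← hbx]
    exact fun h ↦ hb (hcent b (mul_inv_eq_iff_eq_mul.1 h))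
  have hpow : (n : ℤ) ∣ s ^ p - 1 := by
    rw [← heq, ← pow_conj_of_conj_eq_zpow hbx p, ← ht]; group
  obtain ⟨hpn, w, hw, hwn, hps⟩ := exists_geom_sum_eq_prime_mul hp hrad hpow hs htwo
  have hts : (n : ℤ) ∣ t * (s - 1) := by
    have h1 := zpow_conj_of_conj_eq_zpow hbx t
    have h2 : b * x ^ t = x ^ t * b := by rw [ht]; exact (Commute.refl b).pow_right p
    rw [h2, mul_left_inj, eq_comm, heq] at h1
    convert h1 using 1; ring
  have hpt : (p : ℤ) ∣ t := by
    by_contra hpt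
    obtain ⟨u, v, huv⟩ := ((Nat.prime_iff_prime_int.1 hp).coprime_iff_not_dvd).2 hpt
    refine hs ?_
    have := dvd_add (hps.mul_left u) (hts.mul_left v)
    rw [show s - 1 = u * (p * (s - 1)) + v * (t * (s - 1)) by linear_combination -(s - 1) * huv]
    exact this
  -- since `1 + s + ⋯ + s ^ (p - 1) = p * w` with `w` invertible modulo `n`, the equation
  -- `(x ^ e * b) ^ p = 1` can be solved for `e`
  obtain ⟨t', rfl⟩ := hpt
  obtain ⟨u, v, huv⟩ := hwn
  obtain ⟨c, hc⟩ : ∃ c, c = x ^ (-t' * u) * b := ⟨_, rfl⟩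
  have hcp : c ^ p = 1 := by
    rw [hc, zpow_mul_pow_of_conj_eq_zpow hbx, hw, ← ht, ← zpow_add, hone]
    exact ⟨p * t' * v, by linear_combination -p * t' * huv⟩
  have hcA : c ∉ Subgroup.zpowers x := by
    rwa [hc, Subgroup.mul_mem_cancel_left _ (zpow_mem (Subgroup.mem_zpowers x) _)]
  have hcx : c * x * c⁻¹ = x ^ s := by
    rw [hc, ← hbx]
    have : x ^ (-t' * u) * (b * x * b⁻¹) = (b * x * b⁻¹) * x ^ (-t' * u) := by
      rw [hbx, ← zpow_add, ← zpow_add, add_comm]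
    calc x ^ (-t' * u) * b * x * (x ^ (-t' * u) * b)⁻¹
        = x ^ (-t' * u) * (b * x * b⁻¹) * (x ^ (-t' * u))⁻¹ := by group
      _ = _ := by rw [this]; group
  -- conjugation by `g` multiplies `c` by a power of `x` whose exponent is killed by `p`
  have hconj : ∀ g : G, ∃ i : ℤ, g * c * g⁻¹ = x ^ i * c ∧ (n : ℤ) ∣ i * p := by
    intro g
    obtain ⟨r, hr⟩ := Subgroup.mem_zpowers_iff.1 (hnormal.conj_mem x (Subgroup.mem_zpowers x) g)
    have hmem : g * c * g⁻¹ * c⁻¹ ∈ Subgroup.zpowers x := by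
      -- `g * c` and `c * g` act on `x` in the same way
      have h1 : (c * g)⁻¹ * (g * c) ∈ Subgroup.zpowers x := by
        apply hcent
        have e1 : c * g * x = x ^ (s * r) * (c * g) := by
          rw [mul_assoc, mul_inv_eq_iff_eq_mul.1 hr.symm, ← mul_assoc,
            zpow_conj_of_conj_eq_zpow hcx, mul_assoc]
        have e2 : g * c * x = x ^ (s * r) * (g * c) := by
          rw [mul_assoc, mul_inv_eq_iff_eq_mul.1 hcx, ← mul_assoc,
            zpow_conj_of_conj_eq_zpow hr.symm, mul_assoc, mul_comm]
        rw [mul_assoc, e2, inv_mul_eq_iff_eq_mul, ← mul_assoc, ← mul_assoc, e1]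
        group
      convert hnormal.conj_mem _ h1 (c * g) using 1
      group
    obtain ⟨i, hi⟩ := Subgroup.mem_zpowers_iff.1 hmem
    have hi' : g * c * g⁻¹ = x ^ i * c := by rw [hi]; group
    refine ⟨i, hi', ?_⟩
    have h1 : (x ^ i * c) ^ p = 1 := by rw [← hi', conj_pow, hcp]; group
    rw [zpow_mul_pow_of_conj_eq_zpow hcx, hcp, mul_one, hw, hone, ← mul_assoc] at h1
    exact IsCoprime.dvd_of_dvd_mul_right (IsCoprime.symm ⟨u, v, huv⟩) h1
  have hcomm : ∀ a ∈ Group.conjugatesOfSet {c}, ∀ b ∈ Group.conjugatesOfSet {c},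
      a * b = b * a := by
    simp only [Group.mem_conjugatesOfSet_iff, Set.mem_singleton_iff, exists_eq_left, isConj_iff]
    rintro _ ⟨g, rfl⟩ _ ⟨h, rfl⟩
    obtain ⟨i, hi, hip⟩ := hconj g
    obtain ⟨j, hj, hjp⟩ := hconj h
    rw [hi, hj]
    have key : ∀ i j : ℤ, x ^ i * c * (x ^ j * c) = x ^ (i + s * j) * (c * c) := by
      intro i j
      rw [mul_assoc, ← mul_assoc c, zpow_conj_of_conj_eq_zpow hcx, zpow_add]; group
    rw [key, key, mul_left_inj, heq]
    obtain ⟨d, hd⟩ := hrad p hp hpn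
    rw [show i + s * j - (j + s * i) = j * p * d - i * p * d by linear_combination (j - i) * hd]
    exact dvd_sub (hjp.mul_right d) (hip.mul_right d)
  obtain ⟨E, hE⟩ : ∃ E, E = Subgroup.normalClosure {c} := ⟨_, rfl⟩
  have hEn : E.Normal := hE ▸ Subgroup.normalClosure_normal
  have hcE : c ∈ E := hE ▸ Subgroup.subset_normalClosure rfl
  have hEcomm : ∀ a ∈ E, ∀ b ∈ E, a * b = b * a := by
    have := Subgroup.isMulCommutative_closure hcomm
    intro a ha b hb
    rw [hE] at ha hb
    exact congrArg Subtype.val (this.is_comm.comm (⟨a, ha⟩ : Subgroup.closure _) ⟨b, hb⟩)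
  have hEp : ∀ a ∈ E, a ^ p = 1 := by
    intro a ha
    rw [hE] at ha
    refine Subgroup.closure_induction (p := fun a _ ↦ a ^ p = 1) ?_ (one_pow p) ?_ ?_ ha
    · simp only [Group.mem_conjugatesOfSet_iff, Set.mem_singleton_iff, exists_eq_left, isConj_iff]
      rintro _ ⟨g, rfl⟩
      rw [conj_pow, hcp]; group
    · intro a b ha hb h1 h2
      rw [(show Commute a b from hEcomm a (hE ▸ ha) b (hE ▸ hb)).mul_pow, h1, h2, one_mul]
    · intro a _ h1
      rw [inv_pow, h1, inv_one]
  obtain ⟨⟨g, hg⟩, hgen⟩ := (hcyc E hEn hEcomm).exists_generator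
  -- a cyclic group of exponent `p` has order at most `p`, but `E` contains both `c` and a nontrivial
  -- power of `x`
  have hcard : Nat.card E ∣ p := by
    rw [← orderOf_eq_card_of_forall_mem_zpowers hgen, orderOf_dvd_iff_pow_eq_one]
    exact Subtype.ext (hEp g hg)
  have hcard' : Nat.card E = p := by
    refine (hp.eq_one_or_self_of_dvd _ hcard).resolve_left fun h ↦ hcA ?_
    rw [Subgroup.card_eq_one.1 h, Subgroup.mem_bot] at hcE
    exact hcE ▸ one_mem _
  have hmem : x ^ (1 - s) ∈ E := by
    have h1 : x * c * x⁻¹ * c⁻¹ ∈ E := mul_mem (hEn.conj_mem c hcE x) (inv_mem hcE)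
    convert h1 using 1
    rw [zpow_sub, zpow_one, ← hcx]; group
  have hne : (⟨x ^ (1 - s), hmem⟩ : E) ≠ 1 := by
    intro h
    have := (hone _).1 (congrArg Subtype.val h)
    exact hs (by rwa [← dvd_neg, neg_sub])
  have : Fact p.Prime := ⟨hp⟩
  obtain ⟨k, hk⟩ := Subgroup.mem_zpowers_iff.1
    (mem_zpowers_of_prime_card (p := p) hcard' (g' := ⟨c, hcE⟩) hne)
  refine hcA ?_
  rw [← show (x ^ (1 - s)) ^ k = c from congrArg Subtype.val hk]
  exact zpow_mem (zpow_mem (Subgroup.mem_zpowers x) _) _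

open scoped commutatorElement in
/-- In a nilpotent group, `x ^ (s - 1) ^ i` is an `i`-fold commutator of `x` with `b`, so it is trivial
for large `i`. -/
theorem prime_dvd_sub_one_of_conj_eq_zpow {G : Type*} [Group G] [Group.IsNilpotent G]
    {x b : G} {s : ℤ} (h : b * x * b⁻¹ = x ^ s) {q : ℕ} (hq : q.Prime) (hqx : q ∣ orderOf x) :
    (q : ℤ) ∣ s - 1 := by
  obtain ⟨m, hm⟩ := Subgroup.nilpotent_iff_lowerCentralSeries.1 ‹_›
  have hmem : ∀ i : ℕ, x ^ ((s - 1) ^ i) ∈ (⊤ : Subgroup G).lowerCentralSeries i := by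
    intro i
    induction i with
    | zero => simp
    | succ i ih =>
      have h1 := inv_mem (Subgroup.commutator_mem_commutator ih (Subgroup.mem_top b))
      rw [commutatorElement_inv, commutatorElement_def, zpow_conj_of_conj_eq_zpow h,
        mul_inv_cancel_right, ← zpow_neg, ← zpow_add] at h1
      rwa [show (s - 1) ^ (i + 1) = s * (s - 1) ^ i + -(s - 1) ^ i by ring]
  have h1 := hmem m
  rw [hm, Subgroup.mem_bot, ← orderOf_dvd_iff_zpow_eq_one] at h1
  exact (Nat.prime_iff_prime_int.1 hq).dvd_of_dvd_pow ((Int.natCast_dvd_natCast.2 hqx).trans h1)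

open scoped commutatorElement in
/-- A maximal abelian normal subgroup of a finite nilpotent group is its own centralizer. -/
theorem exists_self_centralizing_normal (G : Type*) [Group G] [Finite G] [Group.IsNilpotent G] :
    ∃ A : Subgroup G, A.Normal ∧ (∀ a ∈ A, ∀ b ∈ A, a * b = b * a) ∧
      ∀ g : G, (∀ a ∈ A, g * a = a * g) → g ∈ A := by
  obtain ⟨A, ⟨hA, hAcomm⟩, hmax⟩ := Set.Finite.exists_maximal
    (s := {A : Subgroup G | A.Normal ∧ ∀ a ∈ A, ∀ b ∈ A, a * b = b * a}) (Set.toFinite _)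
    ⟨⊥, inferInstance, by simp⟩
  refine ⟨A, hA, hAcomm, ?_⟩
  -- the centralizer of `A` meets each term of the lower central series inside `A`
  have hmeet : ∀ i : ℕ, (∀ g ∈ (⊤ : Subgroup G).lowerCentralSeries (i + 1),
      (∀ a ∈ A, g * a = a * g) → g ∈ A) →
      ∀ g ∈ (⊤ : Subgroup G).lowerCentralSeries i, (∀ a ∈ A, g * a = a * g) → g ∈ A := by
    intro i hi g hg hgA
    obtain ⟨B, hB⟩ : ∃ B, B = Subgroup.closure (insert g (A : Set G)) := ⟨_, rfl⟩
    have hgB : g ∈ B := hB ▸ Subgroup.subset_closure (Set.mem_insert _ _)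
    have hAB : A ≤ B := fun a ha ↦ hB ▸ Subgroup.subset_closure (Set.mem_insert_of_mem _ ha)
    refine hmax (y := B) ⟨⟨fun b hb h ↦ ?_⟩, ?_⟩ hAB hgB
    · rw [hB] at hb
      refine Subgroup.closure_induction (p := fun b _ ↦ h * b * h⁻¹ ∈ B) ?_ ?_ ?_ ?_ hb
      · rintro y (rfl | hy)
        · have h1 : ⁅y, h⁆⁻¹ ∈ A := by
            refine hi _ (inv_mem (Subgroup.commutator_mem_commutator hg (Subgroup.mem_top h))) ?_
            intro a ha
            have h2 := hgA _ (hA.conj_mem a ha h⁻¹)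
            have h3 : y * h⁻¹ * a = h⁻¹ * a * h * y * h⁻¹ := by
              calc y * h⁻¹ * a = y * (h⁻¹ * a * h⁻¹⁻¹) * h⁻¹ := by group
                _ = _ := by rw [h2]; group
            have h4 : y⁻¹ * a = a * y⁻¹ := by
              rw [inv_mul_eq_iff_eq_mul, ← mul_assoc, hgA a ha]; group
            rw [commutatorElement_inv, commutatorElement_def]
            calc h * y * h⁻¹ * y⁻¹ * a = h * (y * h⁻¹ * a) * y⁻¹ := by
                  rw [mul_assoc _ y⁻¹, h4]; group
              _ = _ := by rw [h3]; group
          convert mul_mem (hAB h1) hgB using 1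
          rw [commutatorElement_inv, commutatorElement_def]; group
        · exact hAB (hA.conj_mem y hy h)
      · simp
      · intro y z _ _ hy hz
        convert mul_mem hy hz using 1
        group
      · intro y _ hy
        convert inv_mem hy using 1
        group
    · have hcomm : ∀ y ∈ insert g (A : Set G), ∀ z ∈ insert g (A : Set G), y * z = z * y := by
        rintro y (rfl | hy) z (rfl | hz)
        · rfl
        · exact hgA z hz
        · exact (hgA y hy).symm
        · exact hAcomm y hy z hz
      have := Subgroup.isMulCommutative_closure hcomm
      intro a ha b hb
      rw [hB] at ha hb
      exact congrArg Subtype.val (this.is_comm.comm (⟨a, ha⟩ : Subgroup.closure _) ⟨b, hb⟩)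
  obtain ⟨m, hm⟩ := Subgroup.nilpotent_iff_lowerCentralSeries.1 ‹_›
  have hall : ∀ j ≤ m, ∀ g ∈ (⊤ : Subgroup G).lowerCentralSeries (m - j),
      (∀ a ∈ A, g * a = a * g) → g ∈ A := by
    intro j
    induction j with
    | zero =>
      intro _ g hg _
      rw [Nat.sub_zero, hm, Subgroup.mem_bot] at hg
      exact hg ▸ one_mem A
    | succ j ih =>
      intro hj
      refine hmeet _ ?_
      rw [show m - (j + 1) + 1 = m - j by omega]
      exact ih (by omega)
  intro g
  exact hall m le_rfl g (by simp)

/-- A finite nilpotent group all of whose abelian normal subgroups are cyclic has a cyclic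
subgroup of index at most two, with explicit relations in the case of index two. -/
theorem exists_cyclic_index_le_two {G : Type*} [Group G] [Finite G] [Group.IsNilpotent G]
    (hcyc : ∀ N : Subgroup G, N.Normal → (∀ a ∈ N, ∀ b ∈ N, a * b = b * a) → IsCyclic N) :
    ∃ x : G, (Subgroup.zpowers x).Normal ∧ (Subgroup.zpowers x = ⊤ ∨
      ∃ (b : G) (s : ℤ), b * x * b⁻¹ = x ^ s ∧ x ^ s ≠ x ∧ b ^ 2 ∈ Subgroup.zpowers x ∧
        b ^ 4 = 1 ∧ Even (orderOf x) ∧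
        ∀ g : G, g ∈ Subgroup.zpowers x ∨ g * b⁻¹ ∈ Subgroup.zpowers x) := by
  obtain ⟨A, hA, hAcomm, hAcent⟩ := exists_self_centralizing_normal G
  obtain ⟨⟨x, hxA⟩, hgen⟩ := (hcyc A hA hAcomm).exists_generator
  obtain rfl : Subgroup.zpowers x = A := by
    refine le_antisymm (Subgroup.zpowers_le.2 hxA) fun a ha ↦ ?_
    obtain ⟨k, hk⟩ := Subgroup.mem_zpowers_iff.1 (hgen ⟨a, ha⟩)
    exact ⟨k, congrArg Subtype.val hk⟩
  refine ⟨x, hA, or_iff_not_imp_left.2 fun htop ↦ ?_⟩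
  have hcent : ∀ g : G, g * x = x * g → g ∈ Subgroup.zpowers x := by
    intro g hg
    refine hAcent g ?_
    rintro _ ⟨k, rfl⟩
    exact (show Commute g x from hg).zpow_right k
  have hact : ∀ g : G, ∃ s : ℤ, g * x * g⁻¹ = x ^ s := fun g ↦ by
    obtain ⟨s, hs⟩ := Subgroup.mem_zpowers_iff.1 (hA.conj_mem x hxA g)
    exact ⟨s, hs.symm⟩
  have hmul : ∀ (g h : G) (s t : ℤ), g * x * g⁻¹ = x ^ s → h * x * h⁻¹ = x ^ t →
      g * h * x * (g * h)⁻¹ = x ^ (s * t) := by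
    intro g h s t hs ht
    calc g * h * x * (g * h)⁻¹ = g * (h * x * h⁻¹) * g⁻¹ := by group
      _ = _ := by rw [ht, zpow_conj_of_conj_eq_zpow hs]; group
  set n := orderOf x with hn
  have hprime : ∀ (g : G) (s : ℤ), g * x * g⁻¹ = x ^ s → ∀ q : ℕ, q.Prime → q ∣ n →
      (q : ℤ) ∣ s - 1 := fun g s hs q hq hqn ↦ prime_dvd_sub_one_of_conj_eq_zpow hs hq hqn
  -- no element outside `⟨x⟩` acts by an exponent congruent to `1` modulo `4`
  have hfour : ∀ (g : G) (s : ℤ), g * x * g⁻¹ = x ^ s → (4 : ℤ) ∣ s - 1 →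
      g ∈ Subgroup.zpowers x := by
    intro g s hs h4
    by_contra hg
    have hord : orderOf (g : G ⧸ Subgroup.zpowers x) ≠ 1 := by
      rwa [Ne, orderOf_eq_one_iff, QuotientGroup.eq_one_iff]
    obtain ⟨p, hp, k, hk⟩ := Nat.exists_prime_and_dvd hord
    have hk0 : 0 < k := by
      have := orderOf_pos (g : G ⧸ Subgroup.zpowers x)
      rw [hk] at this
      exact Nat.pos_of_mul_pos_left this
    have hk1 := pow_conj_of_conj_eq_zpow hs k
    have hgk : g ^ k ∈ Subgroup.zpowers x := by
      refine mem_zpowers_of_pow_prime_mem hcyc hA hcent hp ?_ hk1 (hprime _ _ hk1)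
        fun _ ↦ h4.trans (sub_one_dvd_pow_sub_one s k)
      rw [← QuotientGroup.eq_one_iff, QuotientGroup.mk_pow, QuotientGroup.mk_pow, ← pow_mul,
        ← orderOf_dvd_iff_pow_eq_one, hk, mul_comm]
    rw [← QuotientGroup.eq_one_iff, QuotientGroup.mk_pow, ← orderOf_dvd_iff_pow_eq_one, hk] at hgk
    have := Nat.le_of_dvd hk0 hgk
    nlinarith [hp.two_le]
  -- an exponent `s` matters only modulo `n`: unless `4 ∣ n` and `s ≡ 3 (mod 4)`, some `s + n * k` is
  -- congruent to `1` modulo `4`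
  have hthree : ∀ (g : G) (s : ℤ), g * x * g⁻¹ = x ^ s → g ∉ Subgroup.zpowers x →
      (4 : ℤ) ∣ n ∧ (4 : ℤ) ∣ s + 1 := by
    intro g s hs hg
    have h2 : 2 ∣ n → (2 : ℤ) ∣ s - 1 := fun h ↦ hprime g s hs 2 Nat.prime_two h
    have hshift : ∀ k : ℤ, ¬ (4 : ℤ) ∣ s + n * k - 1 := by
      intro k hk
      refine hg (hfour g (s + n * k) ?_ hk)
      rw [hs, zpow_add, zpow_mul, zpow_natCast, hn, pow_orderOf_eq_one]
      simp
    have h0 := hshift 0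
    have h1 := hshift 1
    have h3 := hshift 2
    have h5 := hshift 3
    have h6 : n % 4 = 0 ∨ n % 4 = 1 ∨ n % 4 = 2 ∨ n % 4 = 3 := by omega
    have h7 : s % 4 = 0 ∨ s % 4 = 1 ∨ s % 4 = 2 ∨ s % 4 = 3 := by omega
    rcases h6 with h6 | h6 | h6 | h6 <;> rcases h7 with h7 | h7 | h7 | h7 <;> omega
  have hprod : ∀ g h : G, g ∉ Subgroup.zpowers x → h ∉ Subgroup.zpowers x →
      g * h ∈ Subgroup.zpowers x := by
    intro g h hg hh
    obtain ⟨s, hs⟩ := hact g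
    obtain ⟨t, ht⟩ := hact h
    refine hfour _ _ (hmul g h s t hs ht) ?_
    obtain ⟨c, hc⟩ := (hthree g s hs hg).2
    obtain ⟨d, hd⟩ := (hthree h t ht hh).2
    exact ⟨4 * c * d - c - d, by linear_combination t * hc + (4 * c - 1) * hd⟩
  obtain ⟨b₀, hb₀⟩ : ∃ b, b ∉ Subgroup.zpowers x := by
    by_contra! h
    exact htop (eq_top_iff.2 fun g _ ↦ h g)
  obtain ⟨s₀, hs₀⟩ := hact b₀
  obtain ⟨h4n, h4s⟩ := hthree b₀ s₀ hs₀ hb₀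
  have hsq := hprod b₀ b₀ hb₀ hb₀
  obtain ⟨t, ht⟩ := Subgroup.mem_zpowers_iff.1 hsq
  have hdvd : (n : ℤ) ∣ t * (s₀ - 1) := by
    have h1 := zpow_conj_of_conj_eq_zpow hs₀ t
    have h2 : b₀ * x ^ t = x ^ t * b₀ := by rw [ht]; group
    rw [h2, mul_left_inj, ← mul_inv_eq_one, ← zpow_neg, ← zpow_add,
      ← orderOf_dvd_iff_zpow_eq_one] at h1
    rw [show t * (s₀ - 1) = -(t + -(s₀ * t)) by ring]
    exact (dvd_neg.2 h1)
  obtain ⟨k, m, hm, hkm⟩ := Nat.exists_eq_two_pow_mul_odd (orderOf_pos x).ne'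
  have hkt : (2 : ℤ) ^ k ∣ 2 * t := by
    obtain ⟨w, hw⟩ : ∃ w, s₀ - 1 = 2 * (2 * w + 1) := ⟨(s₀ - 3) / 4, by omega⟩
    have h1 : (2 : ℤ) ^ k ∣ (2 * t) * (2 * w + 1) := by
      have h2 : (2 : ℤ) ^ k ∣ n := ⟨m, by rw [hn, hkm]; push_cast; ring⟩
      have := h2.trans hdvd
      rw [hw] at this
      rwa [show 2 * t * (2 * w + 1) = t * (2 * (2 * w + 1)) by ring]
    refine IsCoprime.dvd_of_dvd_mul_right (IsCoprime.pow_left ?_) h1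
    exact ⟨-w, 1, by ring⟩
  -- raising `b₀` to the odd part `m` of `n` makes the order divide `4`, as
  -- `b₀ ^ (4 * m) = x ^ (2 * t * m)`
  obtain ⟨l, rfl⟩ := hm
  have hpow : b₀ ^ (2 * l + 1) = x ^ (t * l) * b₀ := by
    rw [pow_succ, pow_mul, pow_two, ← ht, zpow_mul, zpow_natCast]
  have hb : b₀ ^ (2 * l + 1) ∉ Subgroup.zpowers x := by
    rwa [hpow, Subgroup.mul_mem_cancel_left _ (zpow_mem hxA _)]
  obtain ⟨s, hs⟩ := hact (b₀ ^ (2 * l + 1))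
  refine ⟨b₀ ^ (2 * l + 1), s, hs, ?_, ?_, ?_, ?_, ?_⟩
  · intro h
    rw [h] at hs
    exact hb (hcent _ (mul_inv_eq_iff_eq_mul.1 hs))
  · rw [pow_two]; exact hprod _ _ hb hb
  · rw [← pow_mul, show (2 * l + 1) * 4 = 2 * (2 * (2 * l + 1)) by ring, pow_mul, pow_two, ← ht,
      ← zpow_natCast, ← zpow_mul, ← orderOf_dvd_iff_zpow_eq_one, hkm]
    obtain ⟨c, hc⟩ := hkt
    exact ⟨c, by push_cast; linear_combination (2 * (l : ℤ) + 1) * hc⟩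
  · rw [Nat.even_iff]; omega
  · intro g
    by_cases hg : g ∈ Subgroup.zpowers x
    · exact Or.inl hg
    · exact Or.inr (hprod _ _ hg (by simpa using hb))

/-! ### Abelian normal subgroups of primitive linear groups -/

theorem IsIrreducibleLinearGroup.eq_bot_or_eq_top {K V : Type*} [Field K] [AddCommGroup V]
    [Module K V] {G : Subgroup (LinearMap.GeneralLinearGroup K V)}
    (hG : IsIrreducibleLinearGroup G) (U : Submodule K V)
    (hU : ∀ g ∈ G, ∀ v ∈ U, (g : V →ₗ[K] V) v ∈ U) : U = ⊥ ∨ U = ⊤ := by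
  have : IsSimpleOrder (Subrepresentation
    ((Units.coeHom (V →ₗ[K] V)).comp G.subtype : Representation K G V)) := hG
  rcases this.eq_bot_or_eq_top ⟨U, fun g v hv ↦ hU g g.2 v hv⟩ with h | h
  · exact Or.inl (congrArg Subrepresentation.toSubmodule h)
  · exact Or.inr (congrArg Subrepresentation.toSubmodule h)

theorem IsIrreducibleLinearGroup.nontrivial {K V : Type*} [Field K] [AddCommGroup V]
    [Module K V] {G : Subgroup (LinearMap.GeneralLinearGroup K V)}
    (hG : IsIrreducibleLinearGroup G) : Nontrivial V := by
  have : IsSimpleOrder (Subrepresentation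
    ((Units.coeHom (V →ₗ[K] V)).comp G.subtype : Representation K G V)) := hG
  by_contra h
  rw [not_nontrivial_iff_subsingleton] at h
  have h1 : Subsingleton (Submodule K V) := inferInstance
  exact (bot_ne_top (α := Subrepresentation
    ((Units.coeHom (V →ₗ[K] V)).comp G.subtype : Representation K G V)))
    (Subrepresentation.toSubmodule_injective (Subsingleton.elim _ _))

/-- A family of subspaces permuted by a primitive group and forming a direct sum, not all of them
zero, has a member that is the whole space. -/
theorem IsPrimitiveLinearGroup.exists_eq_top {K V : Type*} [Field K] [AddCommGroup V]
    [Module K V] {G : Subgroup (LinearMap.GeneralLinearGroup K V)} (hG : IsPrimitiveLinearGroup G)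
    {ι : Type*} [Finite ι] (U : ι → Submodule K V) (hind : iSupIndep U)
    (hne : ∃ i, U i ≠ ⊥)
    (hperm : ∀ g ∈ G, ∃ σ : Equiv.Perm ι, ∀ i, (U i).map (g : V →ₗ[K] V) = U (σ i)) :
    ∃ i, U i = ⊤ := by
  by_contra! htop
  obtain ⟨r, ⟨e⟩⟩ := Finite.exists_equiv_fin ι
  have hsup : ⨆ i, U i = ⊤ := by
    refine (hG.1.eq_bot_or_eq_top _ fun g hg v hv ↦ ?_).resolve_left fun h ↦ ?_
    · obtain ⟨σ, hσ⟩ := hperm g hg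
      have h1 : (⨆ i, U i).map (g : V →ₗ[K] V) = ⨆ i, U i := by
        rw [Submodule.map_iSup]
        simp_rw [hσ]
        exact σ.iSup_comp (g := U)
      rw [← h1]
      exact Submodule.mem_map_of_mem hv
    · obtain ⟨i, hi⟩ := hne
      exact hi (iSup_eq_bot.1 h i)
  refine hG.2 ⟨r, U ∘ e.symm, ?_, fun i ↦ htop _, fun g hg ↦ ?_⟩
  · refine DirectSum.isInternal_submodule_of_iSupIndep_of_iSup_eq_top ?_ ?_
    · exact hind.comp e.symm.injective
    · rw [← hsup]; exact e.symm.iSup_comp (g := U)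
  · obtain ⟨σ, hσ⟩ := hperm g hg
    exact ⟨(e.symm.trans σ).trans e, fun i ↦ by simp [hσ]⟩

open scoped IsMulCommutative in
/-- The subalgebra of `End V` generated by a set of operators normalized by a primitive group `G`
is a field, provided it is commutative: `V` is the direct sum of the subspaces killed by
the maximal ideals of the subalgebra, and `G` permutes these. -/
theorem IsPrimitiveLinearGroup.isField_adjoin {K V : Type*} [Field K] [AddCommGroup V]
    [Module K V] [FiniteDimensional K V]
    {G : Subgroup (LinearMap.GeneralLinearGroup K V)} (hG : IsPrimitiveLinearGroup G)
    (S : Set (Module.End K V)) (hcomm : ∀ a ∈ S, ∀ b ∈ S, a * b = b * a)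
    (hS : ∀ g ∈ G, ∀ a ∈ S, (g : Module.End K V) * a * (g⁻¹ : LinearMap.GeneralLinearGroup K V) ∈ S) :
    IsField (Algebra.adjoin K S) := by
  have := Algebra.isMulCommutative_adjoin K hcomm
  let R := Algebra.adjoin K S
  have := hG.1.nontrivial
  have : IsArtinianRing R := by
    have : FiniteDimensional K R := inferInstance
    exact IsArtinianRing.of_finite K R
  have hconj : ∀ g ∈ G, ∀ a ∈ R,
      (g : Module.End K V) * a * (g⁻¹ : LinearMap.GeneralLinearGroup K V) ∈ R := by
    intro g hg a ha
    induction ha using Algebra.adjoin_induction with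
    | mem a ha => exact Algebra.subset_adjoin (hS g hg a ha)
    | algebraMap k =>
      rw [← Algebra.commutes, mul_assoc, Units.mul_inv, mul_one]
      exact R.algebraMap_mem k
    | add a b _ _ ha hb => rw [mul_add, add_mul]; exact add_mem ha hb
    | mul a b _ _ ha hb =>
      convert mul_mem ha hb using 1
      simp only [mul_assoc, Units.inv_mul_cancel_left]
  have hconj' : ∀ g ∈ G, ∀ a ∈ R,
      ((g⁻¹ : LinearMap.GeneralLinearGroup K V) : Module.End K V) * a * g ∈ R := by
    intro g hg a ha
    simpa using hconj g⁻¹ (inv_mem hg) a ha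
  -- conjugation by `g` as an automorphism of the algebra
  let c : ∀ g ∈ G, R ≃+* R := fun g hg ↦
    { toFun := fun a ↦ ⟨_, hconj g hg a a.2⟩
      invFun := fun a ↦ ⟨_, hconj' g hg a a.2⟩
      left_inv := fun a ↦ Subtype.ext (by simp [mul_assoc])
      right_inv := fun a ↦ Subtype.ext (by simp [mul_assoc])
      map_mul' := fun a b ↦ Subtype.ext (by simp [mul_assoc])
      map_add' := fun a b ↦ Subtype.ext (by simp [mul_add, add_mul]) }
  have hinv : ∀ (g : LinearMap.GeneralLinearGroup K V) (v : V), g.val (g⁻¹.val v) = v := by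
    intro g v
    rw [← Module.End.mul_apply, Units.mul_inv, Module.End.one_apply]
  have hc : ∀ g (hg : g ∈ G) (a : R) (v : V),
      g⁻¹.val ((c g hg a : Module.End K V) v) = (a : Module.End K V) (g⁻¹.val v) := by
    intro g hg a v
    change g⁻¹.val (g.val ((a : Module.End K V) (g⁻¹.val v))) = _
    simpa using hinv g⁻¹ _
  have hc' : ∀ g (hg : g ∈ G) (a : R) (v : V),
      (a : Module.End K V) (g.val v) = g.val (((c g hg).symm a : Module.End K V) v) :=
    fun g hg a v ↦ (hinv g _).symm
  let U : MaximalSpectrum R → Submodule K V := fun P ↦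
    (Submodule.torsionBySet R V P.asIdeal).restrictScalars K
  have hU : ∀ P v, v ∈ U P ↔ ∀ a ∈ P.asIdeal, (a : Module.End K V) v = 0 := by
    intro P v
    simp only [U, Submodule.restrictScalars_mem, Submodule.mem_torsionBySet_iff]
    exact ⟨fun h a ha ↦ h ⟨a, ha⟩, fun h a ↦ h a a.2⟩
  obtain ⟨P, hP⟩ : ∃ P, U P = ⊤ := by
    refine hG.exists_eq_top U ?_ ?_ ?_
    · have h1 : iSupIndep fun P : MaximalSpectrum R ↦
          Submodule.torsionBySet R V (P.asIdeal : Set R) := by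
        rw [iSupIndep_iff_supIndep]
        refine fun s ↦ Submodule.supIndep_torsionBySet_ideal fun P _ Q _ hPQ ↦ ?_
        exact P.isMaximal.coprime_of_ne Q.isMaximal fun h ↦ hPQ (MaximalSpectrum.ext h)
      rw [iSupIndep_iff_finsetSum_eq_zero_imp_eq_zero] at h1 ⊢
      exact h1
    · -- an associated prime of `V` is maximal, since the algebra is Artinian
      obtain ⟨I, hI⟩ := associatedPrimes.nonempty R V
      obtain ⟨hIp, v, hv⟩ := isAssociatedPrime_iff.1 hI
      have hmax : I.IsMaximal := IsArtinianRing.isMaximal_of_isPrime I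
      refine ⟨⟨I, hmax⟩, fun hbot ↦ hIp.ne_top ?_⟩
      have hvU : v ∈ U ⟨I, hmax⟩ := by
        rw [hU]
        intro a ha
        have ha' : a ∈ (⊥ : Submodule R V).colon {v} := hv ▸ ha
        rwa [Submodule.mem_colon_singleton] at ha'
      rw [hbot, Submodule.mem_bot] at hvU
      rw [hv, hvU]
      simp
    · intro g hg
      refine ⟨⟨fun P ↦ ⟨P.asIdeal.comap (c g hg).symm, inferInstance⟩,
        fun P ↦ ⟨P.asIdeal.comap (c g hg), inferInstance⟩, fun P ↦ ?_, fun P ↦ ?_⟩, fun P ↦ ?_⟩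
      · exact MaximalSpectrum.ext (Ideal.ext fun a ↦ by simp [Ideal.mem_comap])
      · refine MaximalSpectrum.ext (Ideal.ext fun a ↦ ?_)
        rw [Ideal.mem_comap, Ideal.mem_comap, RingEquiv.apply_symm_apply]
      · refine le_antisymm ?_ fun v hv ↦ ?_
        · rintro _ ⟨v, hv, rfl⟩
          rw [hU]
          intro a ha
          refine (hc' g hg a v).trans ?_
          rw [(hU P v).1 hv _ ha, map_zero]
        · refine ⟨g⁻¹.val v, (hU _ _).2 fun a ha ↦ ?_, hinv g v⟩
          rw [← hc g hg a v, (hU _ v).1 hv (c g hg a) ?_, map_zero]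
          change (c g hg).symm (c g hg a) ∈ P.asIdeal
          rwa [RingEquiv.symm_apply_apply]
  -- a maximal ideal killing `V` is zero, since the algebra acts faithfully
  refine Ring.isField_iff_maximal_bot.2 ?_
  convert P.isMaximal
  refine (eq_bot_iff.2 fun a ha ↦ Subtype.ext (LinearMap.ext fun v ↦ ?_)).symm
  exact (hU P v).1 (hP ▸ Submodule.mem_top) a ha

/-- The representation of a linear group on its underlying space. -/
abbrev Subgroup.toEndHom {K V : Type*} [Field K] [AddCommGroup V] [Module K V]
    (G : Subgroup (LinearMap.GeneralLinearGroup K V)) : G →* Module.End K V :=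
  (Units.coeHom (Module.End K V)).comp G.subtype

theorem Subgroup.toEndHom_injective {K V : Type*} [Field K] [AddCommGroup V] [Module K V]
    (G : Subgroup (LinearMap.GeneralLinearGroup K V)) : Function.Injective G.toEndHom :=
  Units.val_injective.comp Subtype.val_injective

theorem IsPrimitiveLinearGroup.isField_adjoin_image {K V : Type*} [Field K] [AddCommGroup V]
    [Module K V] [FiniteDimensional K V]
    {G : Subgroup (LinearMap.GeneralLinearGroup K V)} (hG : IsPrimitiveLinearGroup G)
    {A : Subgroup G} (hA : A.Normal) (hcomm : ∀ a ∈ A, ∀ b ∈ A, a * b = b * a) :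
    IsField (Algebra.adjoin K (G.toEndHom '' A)) := by
  refine hG.isField_adjoin _ ?_ ?_
  · rintro _ ⟨a, ha, rfl⟩ _ ⟨b, hb, rfl⟩
    rw [← map_mul, hcomm a ha b hb, map_mul]
  · rintro g hg _ ⟨a, ha, rfl⟩
    exact ⟨⟨g, hg⟩ * a * ⟨g, hg⟩⁻¹, hA.conj_mem a ha ⟨g, hg⟩, by simp⟩

/-- The inclusion of an abelian normal subgroup into the algebra it generates. -/
def Subgroup.toAdjoinHom {K V : Type*} [Field K] [AddCommGroup V] [Module K V]
    (G : Subgroup (LinearMap.GeneralLinearGroup K V)) (A : Subgroup G) :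
    A →* Algebra.adjoin K (G.toEndHom '' A) where
  toFun a := ⟨G.toEndHom a, Algebra.subset_adjoin ⟨a, a.2, rfl⟩⟩
  map_one' := Subtype.ext (map_one G.toEndHom)
  map_mul' _ _ := Subtype.ext (map_mul G.toEndHom _ _)

theorem Subgroup.toAdjoinHom_injective {K V : Type*} [Field K] [AddCommGroup V] [Module K V]
    (G : Subgroup (LinearMap.GeneralLinearGroup K V)) (A : Subgroup G) :
    Function.Injective (G.toAdjoinHom A) := fun _ _ h ↦
  Subtype.ext (G.toEndHom_injective (congrArg Subtype.val h))

theorem IsPrimitiveLinearGroup.isCyclic {K V : Type*} [Field K] [AddCommGroup V]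
    [Module K V] [FiniteDimensional K V]
    {G : Subgroup (LinearMap.GeneralLinearGroup K V)} [Finite G] (hG : IsPrimitiveLinearGroup G)
    (A : Subgroup G) (hA : A.Normal) (hcomm : ∀ a ∈ A, ∀ b ∈ A, a * b = b * a) :
    IsCyclic A := by
  let := (hG.isField_adjoin_image hA hcomm).toField
  exact isCyclic_of_injective_ringHom (G.toAdjoinHom A) (G.toAdjoinHom_injective A)

/-! ### Intertwining operators -/

open Polynomial in

/-- Two operators annihilated by the same irreducible polynomial are intertwined by a nonzero linear
map: both spaces are nonzero vector spaces over the field `K[X] / (f)`. -/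
theorem exists_ne_zero_intertwining {K V W : Type*} [Field K] [AddCommGroup V] [Module K V]
    [AddCommGroup W] [Module K W] [Nontrivial V] [Nontrivial W] {f : K[X]} (hf : Irreducible f)
    (a : Module.End K V) (c : Module.End K W) (ha : aeval a f = 0) (hc : aeval c f = 0) :
    ∃ T : V →ₗ[K] W, T ≠ 0 ∧ ∀ v, T (a v) = c (T v) := by
  have : Fact (Irreducible f) := ⟨hf⟩
  let φ : AdjoinRoot f →+* Module.End K V :=
    Ideal.Quotient.lift (Ideal.span {f}) (aeval a : K[X] →ₐ[K] Module.End K V).toRingHom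
      (fun p hp ↦ aeval_eq_zero_of_dvd_aeval_eq_zero (Ideal.mem_span_singleton.1 hp) ha)
  let ψ : AdjoinRoot f →+* Module.End K W :=
    Ideal.Quotient.lift (Ideal.span {f}) (aeval c : K[X] →ₐ[K] Module.End K W).toRingHom
      (fun p hp ↦ aeval_eq_zero_of_dvd_aeval_eq_zero (Ideal.mem_span_singleton.1 hp) hc)
  let : Module (AdjoinRoot f) V := Module.compHom V φ
  let : Module (AdjoinRoot f) W := Module.compHom W ψ
  have hV : ∀ (p : K[X]) (v : V), AdjoinRoot.mk f p • v = aeval a p v := fun _ _ ↦ rfl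
  have hW : ∀ (p : K[X]) (w : W), AdjoinRoot.mk f p • w = aeval c p w := fun _ _ ↦ rfl
  obtain ⟨v, hv⟩ := exists_ne (0 : V)
  obtain ⟨w, hw⟩ := exists_ne (0 : W)
  obtain ⟨l, hl⟩ := Module.Projective.exists_dual_ne_zero (AdjoinRoot f) hv
  refine ⟨⟨⟨fun v ↦ l v • w, fun v v' ↦ ?_⟩, fun k v ↦ ?_⟩, fun h ↦ ?_, fun v ↦ ?_⟩
  · rw [map_add, add_smul]
  · have h1 := hV (C k) v
    have h2 := hW (C k) (l v • w)
    rw [aeval_C, Module.algebraMap_end_apply] at h1 h2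
    simp only [RingHom.id_apply]
    rw [← h1, ← h2, map_smul, smul_assoc]
  · exact smul_ne_zero hl hw (LinearMap.congr_fun h v)
  · have h1 := hV X v
    have h2 := hW X (l v • w)
    rw [aeval_X] at h1 h2
    change l (a v) • w = c (l v • w)
    rw [← h1, ← h2, map_smul, smul_assoc]

open Polynomial in
/-- Over a field containing a primitive `n`-th root of unity `ζ`, the minimal polynomial of any
primitive `n`-th root of unity is that of a power of `ζ`. -/
theorem IsPrimitiveRoot.exists_coprime_minpoly_eq {K L M : Type*} [Field K] [Field L] [Field M]
    [Algebra K L] [Algebra K M] {n : ℕ} (hn : 0 < n) {x : M} {ζ : L} (hx : IsPrimitiveRoot x n)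
    (hζ : IsPrimitiveRoot ζ n) : ∃ j : ℕ, j.Coprime n ∧ minpoly K (ζ ^ j) = minpoly K x := by
  have hint : IsIntegral K x := (hx.isIntegral hn).tower_top
  have hirr := minpoly.irreducible hint
  have hdvd : minpoly K x ∣ X ^ n - C 1 := minpoly.dvd K x (by simp [hx.pow_eq_one])
  have hsplit : ((minpoly K x).map (algebraMap K L)).Splits := by
    refine (X_pow_sub_one_splits hζ).of_dvd ?_ ?_
    · exact (monic_X_pow_sub_C _ hn.ne').ne_zero
    · simpa using Polynomial.map_dvd (algebraMap K L) hdvd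
  obtain ⟨y, hy⟩ := hsplit.exists_eval_eq_zero (by
    rw [degree_map]; exact (minpoly.degree_pos hint).ne')
  rw [eval_map_algebraMap] at hy
  have hmin : minpoly K x = minpoly K y :=
    minpoly.eq_of_irreducible_of_monic hirr hy (minpoly.monic hint)
  have hpow : ∀ d : ℕ, x ^ d = 1 ↔ y ^ d = 1 := by
    intro d
    have h1 := minpoly.dvd_iff (A := K) (x := x) (p := X ^ d - 1)
    have h2 := minpoly.dvd_iff (A := K) (x := y) (p := X ^ d - 1)
    rw [hmin, h2] at h1
    simpa [sub_eq_zero] using h1.symm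
  have hyprim : IsPrimitiveRoot y n :=
    ⟨(hpow n).1 hx.pow_eq_one, fun l hl ↦ hx.dvd_of_pow_eq_one l ((hpow l).2 hl)⟩
  have : NeZero n := ⟨hn.ne'⟩
  obtain ⟨j, -, hj, rfl⟩ := hζ.isPrimitiveRoot_iff.1 hyprim
  exact ⟨j, hj, hmin.symm⟩

theorem intertwining_zpow {K V W G H : Type*} [Field K] [AddCommGroup V] [Module K V]
    [AddCommGroup W] [Module K W] [Group G] [Group H] (ρ : G →* Module.End K V)
    (τ : H →* Module.End K W) {x : G} {y : H} {T : V →ₗ[K] W}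
    (hT : ∀ v, T (ρ x v) = τ y (T v)) (k : ℤ) (v : V) :
    T (ρ (x ^ k) v) = τ (y ^ k) (T v) := by
  have hmul : ∀ (g h : G) v, ρ g (ρ h v) = ρ (g * h) v := fun g h v ↦ by rw [map_mul]; rfl
  have hmul' : ∀ (g h : H) w, τ g (τ h w) = τ (g * h) w := fun g h v ↦ by rw [map_mul]; rfl
  have hnat : ∀ k : ℕ, ∀ v, T (ρ (x ^ k) v) = τ (y ^ k) (T v) := by
    intro k
    induction k with
    | zero => simp
    | succ k ih => intro v; rw [pow_succ', ← hmul, hT, ih, hmul', pow_succ']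
  obtain ⟨m, rfl | rfl⟩ := k.eq_nat_or_neg
  · simpa using hnat m v
  · have h1 := hnat m (ρ (x ^ (-(m : ℤ))) v)
    rw [hmul] at h1
    have h2 := congrArg (τ (y ^ (-(m : ℤ)))) h1
    rw [hmul'] at h2
    simpa using h2.symm

/-- If `T` intertwines `x` with `y`, then averaging `T` over the involution `T ↦ d T b⁻¹` gives an
operator that also intertwines `b` with `d`. It vanishes neither for `T` nor for `y T` unless
`y` and `d y d⁻¹` agree on the range of `T`. -/
theorem exists_ne_zero_intertwining_pair {K V W G H : Type*} [Field K] [AddCommGroup V] [Module K V]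
    [AddCommGroup W] [Module K W] [Group G] [Group H] (ρ : G →* Module.End K V)
    (τ : H →* Module.End K W) {x b : G} {y d : H} {s u : ℤ} (hx : b⁻¹ * x * b = x ^ u)
    (hy : d⁻¹ * y * d = y ^ u) (hs : d * y * d⁻¹ = y ^ s)
    (hdy : y * d ^ 2 = d ^ 2 * y) (hinj : ∀ w, τ (y ^ s) w = τ y w → w = 0)
    {T : V →ₗ[K] W} (hT : T ≠ 0) (hTx : ∀ v, T (ρ x v) = τ y (T v))
    (hTb : ∀ v, T (ρ (b ^ 2) v) = τ (d ^ 2) (T v)) :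
    ∃ T' : V →ₗ[K] W, T' ≠ 0 ∧ (∀ v, T' (ρ x v) = τ y (T' v)) ∧
      ∀ v, T' (ρ b v) = τ d (T' v) := by
  have hmul : ∀ (g h : G) v, ρ g (ρ h v) = ρ (g * h) v := fun g h v ↦ by rw [map_mul]; rfl
  have hmul' : ∀ (g h : H) w, τ g (τ h w) = τ (g * h) w := fun g h v ↦ by rw [map_mul]; rfl
  -- the averaged operator intertwines both pairs
  have havg : ∀ S : V →ₗ[K] W, (∀ v, S (ρ x v) = τ y (S v)) →
      (∀ v, S (ρ (b ^ 2) v) = τ (d ^ 2) (S v)) →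
      (∀ v, (S + τ d ∘ₗ S ∘ₗ ρ b⁻¹) (ρ x v) = τ y ((S + τ d ∘ₗ S ∘ₗ ρ b⁻¹) v)) ∧
      ∀ v, (S + τ d ∘ₗ S ∘ₗ ρ b⁻¹) (ρ b v) = τ d ((S + τ d ∘ₗ S ∘ₗ ρ b⁻¹) v) := by
    intro S hSx hSb
    refine ⟨fun v ↦ ?_, fun v ↦ ?_⟩
    · have h1 : b⁻¹ * x = x ^ u * b⁻¹ := by rw [← hx]; group
      have h2 : d * y ^ u = y * d := by rw [← hy]; group
      simp only [LinearMap.add_apply, LinearMap.comp_apply, map_add, hSx]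
      rw [hmul, h1, ← hmul, intertwining_zpow ρ τ hSx, hmul', hmul', h2]
    · simp only [LinearMap.add_apply, LinearMap.comp_apply, map_add]
      rw [hmul, hmul', ← pow_two, ← hSb, hmul, inv_mul_cancel, map_one, Module.End.one_apply,
        pow_two, mul_inv_cancel_right, add_comm]
  by_cases h0 : T + τ d ∘ₗ T ∘ₗ ρ b⁻¹ = 0
  · refine ⟨_, fun h1 ↦ hT (LinearMap.ext fun v ↦ ?_),
      havg (τ y ∘ₗ T) (fun v ↦ ?_) (fun v ↦ ?_)⟩
    · have h2 : T v + τ d (T (ρ b⁻¹ v)) = 0 := LinearMap.congr_fun h0 v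
      have h3 : τ y (T v) + τ d (τ y (T (ρ b⁻¹ v))) = 0 := LinearMap.congr_fun h1 v
      have h4 : d * y = y ^ s * d := by rw [← hs]; group
      rw [hmul', h4, ← hmul', eq_neg_of_add_eq_zero_right h2, map_neg, ← sub_eq_add_neg,
        sub_eq_zero] at h3
      exact hinj _ h3.symm
    · simp only [LinearMap.comp_apply, hTx]
    · simp only [LinearMap.comp_apply, hTb]
      rw [hmul', hmul', hdy]
  · exact ⟨_, h0, havg T hTx hTb⟩

/-- A nonzero operator matching the elements of an irreducible group with those of
another one is an isomorphism conjugating the first group to the second. -/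
theorem areSimilarLinearGroups_of_intertwining {K V W : Type*} [Field K] [AddCommGroup V]
    [Module K V] [AddCommGroup W] [Module K W]
    {G : Subgroup (LinearMap.GeneralLinearGroup K V)}
    {H : Subgroup (LinearMap.GeneralLinearGroup K W)} (hG : IsIrreducibleLinearGroup G)
    (hH : IsIrreducibleLinearGroup H) {T : V →ₗ[K] W} (hT : T ≠ 0)
    (hGH : ∀ g : G, ∃ h : H, ∀ v, T (G.toEndHom g v) = H.toEndHom h (T v))
    (hHG : ∀ h : H, ∃ g : G, ∀ v, T (G.toEndHom g v) = H.toEndHom h (T v)) :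
    AreSimilarLinearGroups G H := by
  have hker : LinearMap.ker T = ⊥ := by
    refine (hG.eq_bot_or_eq_top _ fun g hg v hv ↦ ?_).resolve_right fun h ↦
      hT (LinearMap.ker_eq_top.1 h)
    obtain ⟨h, hh⟩ := hGH ⟨g, hg⟩
    rw [LinearMap.mem_ker] at hv ⊢
    exact (hh v).trans (by rw [hv, map_zero])
  have hrange : LinearMap.range T = ⊤ := by
    refine (hH.eq_bot_or_eq_top _ fun h hh ↦ ?_).resolve_left fun h ↦
      hT (LinearMap.range_eq_bot.1 h)
    rintro _ ⟨v, rfl⟩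
    obtain ⟨g, hg⟩ := hHG ⟨h, hh⟩
    exact ⟨_, hg v⟩
  let θ : V ≃ₗ[K] W := LinearEquiv.ofBijective T
    ⟨LinearMap.ker_eq_bot.1 hker, LinearMap.range_eq_top.1 hrange⟩
  have hconj : ∀ (g : G) (h : H), (∀ v, T (G.toEndHom g v) = H.toEndHom h (T v)) →
      LinearMap.GeneralLinearGroup.congrLinearEquiv θ g = h := by
    intro g h hgh
    refine Units.ext (LinearMap.ext fun w ↦ ?_)
    obtain ⟨v, rfl⟩ := θ.surjective w
    refine Eq.trans ?_ (hgh v)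
    change θ ((g : LinearMap.GeneralLinearGroup K V).1 (θ.symm (θ v))) = _
    rw [θ.symm_apply_apply]
    rfl
  refine ⟨θ, le_antisymm ?_ fun h hh ↦ ?_⟩
  · rintro _ ⟨g, hg, rfl⟩
    obtain ⟨h, hh⟩ := hGH ⟨g, hg⟩
    have := hconj ⟨g, hg⟩ h hh
    exact this ▸ h.2
  · obtain ⟨g, hg⟩ := hHG ⟨h, hh⟩
    exact ⟨g, g.2, hconj g ⟨h, hh⟩ hg⟩

theorem mul_comm_of_mem_zpowers {G : Type*} [Group G] (x : G) :
    ∀ a ∈ Subgroup.zpowers x, ∀ b ∈ Subgroup.zpowers x, a * b = b * a := by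
  rintro _ ⟨k, rfl⟩ _ ⟨l, rfl⟩
  exact zpow_mul_comm x k l

/-- In a primitive linear group, distinct elements of an abelian normal subgroup differ by an
invertible operator. -/
theorem IsPrimitiveLinearGroup.eq_zero_of_apply_eq {K V : Type*} [Field K] [AddCommGroup V]
    [Module K V] [FiniteDimensional K V]
    {G : Subgroup (LinearMap.GeneralLinearGroup K V)} (hG : IsPrimitiveLinearGroup G)
    {A : Subgroup G} (hA : A.Normal) (hcomm : ∀ a ∈ A, ∀ b ∈ A, a * b = b * a) {a b : G}
    (ha : a ∈ A) (hb : b ∈ A) (hab : a ≠ b) {v : V} (hv : G.toEndHom a v = G.toEndHom b v) :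
    v = 0 := by
  have hR := hG.isField_adjoin_image hA hcomm
  obtain ⟨r, hr⟩ := hR.mul_inv_cancel
    (sub_ne_zero.2 fun h ↦ hab (congrArg Subtype.val (G.toAdjoinHom_injective A h)) :
      G.toAdjoinHom A ⟨a, ha⟩ - G.toAdjoinHom A ⟨b, hb⟩ ≠ 0)
  rw [hR.mul_comm] at hr
  have h1 := LinearMap.congr_fun (congrArg Subtype.val hr) v
  change r.val (G.toEndHom a v - G.toEndHom b v) = v at h1
  rw [← h1, hv, sub_self, map_zero]

open Polynomial in
/-- If `x` and `z` generate cyclic normal subgroups of the same order in primitive groups, then `x`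
has the minimal polynomial of a power of `z`, so the two are intertwined by a nonzero map. -/
theorem IsPrimitiveLinearGroup.exists_coprime_intertwining {K V W : Type*} [Field K]
    [AddCommGroup V] [Module K V] [FiniteDimensional K V] [AddCommGroup W] [Module K W]
    [FiniteDimensional K W] {G : Subgroup (LinearMap.GeneralLinearGroup K V)}
    {H : Subgroup (LinearMap.GeneralLinearGroup K W)} [Finite G]
    (hG : IsPrimitiveLinearGroup G) (hH : IsPrimitiveLinearGroup H) {x : G} {z : H}
    (hx : (Subgroup.zpowers x).Normal) (hz : (Subgroup.zpowers z).Normal)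
    (hord : orderOf z = orderOf x) :
    ∃ j : ℕ, j.Coprime (orderOf x) ∧ ∃ T : V →ₗ[K] W, T ≠ 0 ∧
      ∀ v, T (G.toEndHom x v) = H.toEndHom (z ^ j) (T v) := by
  have := hG.1.nontrivial
  have := hH.1.nontrivial
  let := (hG.isField_adjoin_image hx (mul_comm_of_mem_zpowers x)).toField
  let := (hH.isField_adjoin_image hz (mul_comm_of_mem_zpowers z)).toField
  set ξ := G.toAdjoinHom _ ⟨x, Subgroup.mem_zpowers x⟩ with hξ
  set ζ := H.toAdjoinHom _ ⟨z, Subgroup.mem_zpowers z⟩ with hζ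
  have hξn : IsPrimitiveRoot ξ (orderOf x) := by
    rw [IsPrimitiveRoot.iff_orderOf, hξ, orderOf_injective _ (G.toAdjoinHom_injective _),
      Subgroup.orderOf_mk]
  have hζn : IsPrimitiveRoot ζ (orderOf x) := by
    rw [IsPrimitiveRoot.iff_orderOf, hζ, orderOf_injective _ (H.toAdjoinHom_injective _),
      Subgroup.orderOf_mk, hord]
  obtain ⟨j, hj, hmin⟩ := hξn.exists_coprime_minpoly_eq (K := K) (orderOf_pos x) hζn
  refine ⟨j, hj, exists_ne_zero_intertwining
    (minpoly.irreducible (hξn.isIntegral (orderOf_pos x)).tower_top) _ _ ?_ ?_⟩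
  · exact (aeval_subalgebra_coe _ _ ξ).symm.trans (congrArg Subtype.val (minpoly.aeval K ξ))
  · have h1 : H.toEndHom (z ^ j) = (ζ ^ j : Algebra.adjoin K _) := by
      rw [map_pow]; rfl
    rw [h1, ← hmin]
    exact (aeval_subalgebra_coe _ _ (ζ ^ j)).symm.trans
      (congrArg Subtype.val (minpoly.aeval K (ζ ^ j)))

/-! ### Similarity of isomorphic primitive nilpotent groups -/

theorem mainTheorem2 {K V W : Type*} [Field K] [CharZero K]
    [AddCommGroup V] [Module K V] [FiniteDimensional K V]
    [AddCommGroup W] [Module K W] [FiniteDimensional K W]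
    (G : Subgroup (LinearMap.GeneralLinearGroup K V))
    (H : Subgroup (LinearMap.GeneralLinearGroup K W))
    [Finite G] [Finite H] [Group.IsNilpotent G] [Group.IsNilpotent H]
    (hG : IsPrimitiveLinearGroup G) (hH : IsPrimitiveLinearGroup H)
    (hGH : Nonempty (G ≃* H)) :
    AreSimilarLinearGroups G H := by
  obtain ⟨φ⟩ := hGH
  obtain ⟨x, hxn, hx⟩ := exists_cyclic_index_le_two (G := G) hG.isCyclic
  have hmap : (Subgroup.zpowers x).map φ.toMonoidHom = Subgroup.zpowers (φ x) :=
    φ.toMonoidHom.map_zpowers x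
  have hzn : (Subgroup.zpowers (φ x)).Normal :=
    hmap ▸ hxn.map φ.toMonoidHom φ.surjective
  obtain ⟨j, hj, T, hT, hTx⟩ := hG.exists_coprime_intertwining hH hxn hzn (φ.orderOf_eq x)
  have hxj : x ∈ Subgroup.zpowers (x ^ j) := mem_zpowers_pow_iff.2 hj
  obtain ⟨y, hy⟩ : ∃ y, y = φ (x ^ j) := ⟨_, rfl⟩
  rw [← map_pow, ← hy] at hTx
  have hmem : ∀ g ∈ Subgroup.zpowers x, φ g ∈ Subgroup.zpowers y := by
    intro g hg
    obtain ⟨k, rfl⟩ := Subgroup.mem_zpowers_iff.1 (Subgroup.zpowers_le.2 hxj hg)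
    exact ⟨k, by rw [hy, map_zpow]⟩
  -- elements of `⟨x⟩` are matched with elements of `φ ⟨x⟩`
  have hfst : ∀ g ∈ Subgroup.zpowers x, ∃ h : H, ∀ S : V →ₗ[K] W,
      (∀ v, S (G.toEndHom x v) = H.toEndHom y (S v)) →
      ∀ v, S (G.toEndHom g v) = H.toEndHom h (S v) := by
    rintro _ ⟨k, rfl⟩
    exact ⟨y ^ k, fun S hS ↦ intertwining_zpow G.toEndHom H.toEndHom hS k⟩
  have hsnd : ∀ g ∈ Subgroup.zpowers x, ∃ g' : G, ∀ S : V →ₗ[K] W,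
      (∀ v, S (G.toEndHom x v) = H.toEndHom y (S v)) →
      ∀ v, S (G.toEndHom g' v) = H.toEndHom (φ g) (S v) := by
    intro g hg
    obtain ⟨k, hk⟩ := Subgroup.mem_zpowers_iff.1 (hmem g hg)
    exact ⟨x ^ k, fun S hS ↦ hk ▸ intertwining_zpow G.toEndHom H.toEndHom hS k⟩
  rcases hx with htop | ⟨b, s, hs, hsx, hb2, hb4, heven, hcover⟩
  · refine areSimilarLinearGroups_of_intertwining hG.1 hH.1 hT (fun g ↦ ?_) fun h ↦ ?_
    · obtain ⟨h, hh⟩ := hfst g (htop ▸ Subgroup.mem_top g)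
      exact ⟨h, hh T hTx⟩
    · obtain ⟨g, rfl⟩ := φ.surjective h
      obtain ⟨g', hg'⟩ := hsnd g (htop ▸ Subgroup.mem_top g)
      exact ⟨g', hg' T hTx⟩
  have hconj : ∀ (c : G) (k : ℤ), c * x * c⁻¹ = x ^ k → φ c * y * (φ c)⁻¹ = y ^ k := by
    intro c k hc
    rw [hy, ← map_inv, ← map_mul, ← map_mul, ← map_zpow, ← conj_pow, hc, ← zpow_natCast,
      ← zpow_natCast, ← zpow_mul, ← zpow_mul, mul_comm]
  obtain ⟨u, hu⟩ := Subgroup.mem_zpowers_iff.1 (hxn.conj_mem x (Subgroup.mem_zpowers x) b⁻¹)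
  have hyu := hconj _ u hu.symm
  have hys := hconj b s hs
  -- `φ (b ^ 2)` is its own `j`-th power, because `j` is odd and `b ^ 4 = 1`
  obtain ⟨t, ht⟩ := Subgroup.mem_zpowers_iff.1 hb2
  have hyt : y ^ t = φ b ^ 2 := by
    have hodd : Odd j := by
      rw [← Nat.not_even_iff_odd, even_iff_two_dvd]
      intro h2
      exact absurd (Nat.dvd_gcd h2 heven.two_dvd) (by rw [hj]; decide)
    obtain ⟨i, rfl⟩ := hodd
    have h1 : (x ^ (2 * i + 1)) ^ t = b ^ 2 := by
      calc (x ^ (2 * i + 1)) ^ t = (x ^ t) ^ (2 * i + 1) := by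
            rw [← zpow_natCast, ← zpow_natCast, ← zpow_mul, ← zpow_mul, mul_comm]
        _ = (b ^ 4) ^ i * b ^ 2 := by rw [ht, ← pow_mul, ← pow_mul, ← pow_add]; congr 1; ring
        _ = b ^ 2 := by rw [hb4, one_pow, one_mul]
    rw [hy, ← map_zpow, h1, map_pow]
  have hne : y ^ s ≠ y := by
    intro h
    have h1 : (x ^ j) ^ s = x ^ j := φ.injective (by rw [map_zpow, ← hy, h])
    obtain ⟨k, hk⟩ := Subgroup.mem_zpowers_iff.1 hxj
    refine hsx ?_
    calc x ^ s = ((x ^ j) ^ k) ^ s := by rw [hk]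
      _ = ((x ^ j) ^ s) ^ k := by rw [← zpow_mul, ← zpow_mul, mul_comm]
      _ = x := by rw [h1, hk]
  have hyA : y ∈ Subgroup.zpowers (φ x) := ⟨j, by simp [hy]⟩
  obtain ⟨S, hS, hSx, hSb⟩ := exists_ne_zero_intertwining_pair G.toEndHom H.toEndHom
    (x := x) (b := b) (y := y) (d := φ b) (s := s) (u := u) (by rw [hu, inv_inv])
    (by simpa using hyu) hys (by rw [← hyt, ← zpow_one_add, ← zpow_add_one, add_comm])
    (fun w hw ↦ hH.eq_zero_of_apply_eq hzn (mul_comm_of_mem_zpowers _) (zpow_mem hyA s) hyA hne hw)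
    hT hTx fun v ↦ by
      rw [← ht, ← hyt]
      exact intertwining_zpow G.toEndHom H.toEndHom hTx t v
  refine areSimilarLinearGroups_of_intertwining hG.1 hH.1 hS (fun g ↦ ?_) fun h ↦ ?_
  · rcases hcover g with hg | hg
    · obtain ⟨h, hh⟩ := hfst g hg
      exact ⟨h, hh S hSx⟩
    · obtain ⟨h, hh⟩ := hfst _ hg
      refine ⟨h * φ b, fun v ↦ ?_⟩
      rw [map_mul, Module.End.mul_apply, ← hSb, ← hh S hSx, ← Module.End.mul_apply, ← map_mul,
        inv_mul_cancel_right]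
  · obtain ⟨g, rfl⟩ := φ.surjective h
    rcases hcover g with hg | hg
    · obtain ⟨g', hg'⟩ := hsnd g hg
      exact ⟨g', hg' S hSx⟩
    · obtain ⟨g', hg'⟩ := hsnd _ hg
      refine ⟨g' * b, fun v ↦ ?_⟩
      rw [map_mul, Module.End.mul_apply, hg' S hSx, hSb, ← Module.End.mul_apply, ← map_mul,
        ← map_mul, inv_mul_cancel_right]
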